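/- Represent the circle $\mathbb S^1$, with a fixed origin and anticlockwise orientation, by $[0,2\pi)$ with Lebesgue measure $dx$, and write $\|\cdot\|_2$ for the norm of $L^2(\mathbb S^1)$ and $\langle g,h\rangle_2=\int_0^{2\pi}g(x)h(x)\,dx$. For $l,u\in[0,2\pi)$ let the arc $[l,u]$ be the usual interval if $l\le u$, and $[l,u]=[0,2\pi)\setminus(u,l)$ if $l>u$. Let $\varphi_0=\frac1{\sqrt{2\pi}}$ and, for $j\ge1$, $\varphi_{2j-1}(x)=\frac1{\sqrt\pi}\cos(jx)$, $\varphi_{2j}(x)=\frac1{\sqrt\pi}\sin(jx)$; let $\alpha_j=j^\beta$ for even $j\ge0$ and $\alpha_j=(j+1)^\beta$ for odd $j$. For $\beta,R>0$ put $$W(\beta,R)=\Big\{g\in L^2(\mathbb S^1):\ \sum_{j=0}^{\infty}\alpha_j^2\,|\langle g,\varphi_j\rangle_2|^2<\frac{R^2}{\pi^{2\beta}}\Big\}.$$ Censored circular model: let $Q$ be a probability law on $[0,2\pi)^2$ such that $L\neq U$ almost surely when $(L,U)\sim Q$. Let $(X_i,L_i,U_i)_{1\le i\le n}$ be i.i.d.,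 where $X_i$ has a probability density $f$ on $\mathbb S^1$, $(L_i,U_i)\sim Q$, and $X_i$ is independent of $(L_i,U_i)$. One observes $(X_i',L_i,U_i)_{1\le i\le n}$, where $X_i'=X_i$ if $X_i\in[L_i,U_i]$ and $X_i'=-\pi$ otherwise. Denote by $\mathbb E_f$ the expectation when the density is $f$. **Theorem.** Let $\beta\ge\frac12$ and $R>0$. There is a constant $c>0$ depending only on $\beta$ and $R$ such that, for every such law $Q$, $$\liminf_{n\to\infty}\ \inf_{\hat f}\ \sup_{f}\ \mathbb E_f\Big(n^{\frac{2\beta}{2\beta+1}}\,\|\hat f-f\|_2^2\Big)\ \ge\ c,$$ where the infimum is over all estimators $\hat f$ (measurable functions of the sample $(X_1',L_1,U_1),\dots,(X_n',L_n,U_n)$ and of the point of the circle; they may depend on $Q$, and the risk may be $+\infty$), and the supremum is over all probability densities $f\in W(\beta,R)$. -/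

import Mathlib

open MeasureTheory Filter
open scoped ENNReal

noncomputable section

namespace CircularCensoring

/-- The circle `𝕊¹`, with a fixed origin and the anticlockwise orientation, is represented by
`[0, 2π)`. -/
def circle : Set ℝ := Set.Ico 0 (2 * Real.pi)

/-- The arc length measure on the circle (of total mass `2π`). -/
def arcMeasure : Measure ℝ := volume.restrict circle

/-- The closed arc `[l, u]`: the points met when moving anticlockwise from `l` to `u`. For `l > u`
it is the complement in the circle of the ordinary open interval `(u, l)`. -/
def arc (l u : ℝ) : Set ℝ := if l ≤ u then Set.Icc l u else circle \ Set.Ioo u l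

open Classical in
/-- The censoring mechanism `(X, L, U) ↦ (X', L, U)`, where `X' = X` if `X ∈ [L, U]` and `X' = -π`
otherwise. -/
def censor (p : ℝ × ℝ × ℝ) : ℝ × ℝ × ℝ :=
  (if p.1 ∈ arc p.2.1 p.2.2 then p.1 else -Real.pi, p.2)

/-- The law of a circular random variable `X` with density `f`. -/
def lawX (f : ℝ → ℝ) : Measure ℝ := arcMeasure.withDensity fun x => ENNReal.ofReal (f x)

/-- The law of one observation `(X', L, U)`, when `X` has density `f`, `(L, U)` has law `Q`, and
`X` is independent of `(L, U)`. -/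
def obsLaw (f : ℝ → ℝ) (Q : Measure (ℝ × ℝ)) : Measure (ℝ × ℝ × ℝ) :=
  ((lawX f).prod Q).map censor

/-- The law of the sample `(X'₁, L₁, U₁), …, (X'ₙ, Lₙ, Uₙ)` of independent observations. -/
def sampleLaw (n : ℕ) (f : ℝ → ℝ) (Q : Measure (ℝ × ℝ)) : Measure (Fin n → ℝ × ℝ × ℝ) :=
  Measure.pi fun _ => obsLaw f Q

/-- The real trigonometric basis of `L²(𝕊¹)`: `φ₀ = 1/√(2π)`, `φ_{2k-1} = cos(k·)/√π` and
`φ_{2k} = sin(k·)/√π` for `k ≥ 1`. -/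
def trigBasis (j : ℕ) (x : ℝ) : ℝ :=
  if j = 0 then 1 / √(2 * Real.pi)
  else if Even j then 1 / √Real.pi * Real.sin ((j : ℝ) / 2 * x)
  else 1 / √Real.pi * Real.cos (((j : ℝ) + 1) / 2 * x)

/-- `α_j = j^β` for even `j` and `α_j = (j+1)^β` for odd `j`. -/
def sobolevWeight (β : ℝ) (j : ℕ) : ℝ :=
  if Even j then (j : ℝ) ^ β else ((j : ℝ) + 1) ^ β

/-- The Sobolev class `W(β, R)`. -/
def sobolevClass (β R : ℝ) : Set (ℝ → ℝ) :=
  {g | MemLp g 2 arcMeasure ∧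
    ∑' j : ℕ, ENNReal.ofReal
      (sobolevWeight β j ^ 2 * |∫ x, g x * trigBasis j x ∂arcMeasure| ^ 2)
      < ENNReal.ofReal (R ^ 2 / Real.pi ^ (2 * β))}

/-- The probability densities on the circle. -/
def densities : Set (ℝ → ℝ) :=
  {f | Integrable f arcMeasure ∧ (∀ᵐ x ∂arcMeasure, 0 ≤ f x) ∧ ∫ x, f x ∂arcMeasure = 1}

/-- The estimators of a function on the circle from `n` observations: to a sample they attach a
function, measurably in the sample and the point jointly. -/
def estimators (n : ℕ) : Set ((Fin n → ℝ × ℝ × ℝ) → ℝ → ℝ) :=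
  {fhat | Measurable (Function.uncurry fhat)}

/-- The expectation `E_f (r ‖f̂ - f‖₂²)`, a value in `[0, ∞]`. -/
def scaledRisk (n : ℕ) (Q : Measure (ℝ × ℝ)) (r : ℝ)
    (fhat : (Fin n → ℝ × ℝ × ℝ) → ℝ → ℝ) (f : ℝ → ℝ) : ℝ≥0∞ :=
  ∫⁻ z, ENNReal.ofReal r * eLpNorm (fun x => fhat z x - f x) 2 arcMeasure ^ 2 ∂(sampleLaw n f Q)

/-- `Q` is the law of a pair `(L, U)` of points of the circle with `L ≠ U` almost surely. -/
def IsCensoringLaw (Q : Measure (ℝ × ℝ)) : Prop :=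
  IsProbabilityMeasure Q ∧ (∀ᵐ p ∂Q, p.1 ∈ circle ∧ p.2 ∈ circle) ∧ ∀ᵐ p ∂Q, p.1 ≠ p.2

/-- The censoring map is measurable, so that `obsLaw` is a genuine image measure. -/
theorem measurable_censor : Measurable censor := by
  classical
  have hs : MeasurableSet {p : ℝ × ℝ × ℝ | p.1 ∈ arc p.2.1 p.2.2} := by
    have : {p : ℝ × ℝ × ℝ | p.1 ∈ arc p.2.1 p.2.2} =
        ({p | p.2.1 ≤ p.2.2} ∩ ({p | p.2.1 ≤ p.1} ∩ {p | p.1 ≤ p.2.2})) ∪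
        ({p | p.2.2 < p.2.1} ∩ (({p | 0 ≤ p.1} ∩ {p | p.1 < 2 * Real.pi}) ∩
          ({p | p.1 ≤ p.2.2} ∪ {p | p.2.1 ≤ p.1}))) := by
      ext p
      by_cases h : p.2.1 ≤ p.2.2
      · simp [arc, h, not_lt.2 h]
      · simp only [arc, h, circle, if_false, Set.mem_ofPred_eq, Set.mem_sdiff, Set.mem_Ico,
          Set.mem_Ioo, Set.mem_union, Set.mem_inter_iff, false_and, false_or, not_le.1 h, true_and,
          not_and_or, not_lt]
    rw [this]
    refine MeasurableSet.union (MeasurableSet.inter ?_ (MeasurableSet.inter ?_ ?_))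
      (MeasurableSet.inter ?_ (MeasurableSet.inter (MeasurableSet.inter ?_ ?_)
        (MeasurableSet.union ?_ ?_)))
    all_goals first
      | exact measurableSet_le (by fun_prop) (by fun_prop)
      | exact measurableSet_lt (by fun_prop) (by fun_prop)
  exact (Measurable.ite hs measurable_fst measurable_const).prodMk measurable_snd

end CircularCensoring

end

noncomputable section

namespace CircularCensoring

/-! Assouad's hypercube argument. Perturb the uniform density by `δ` times a signed sum of the first
`N` cosine basis functions, with `N` of order `n^(1/(2β+1))` and `δ²` of order `1/n`. All `2^N` sign
patterns give densities in the Sobolev ball, and each sign costs `δ²` of squared loss, so the total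
`N δ²` has order `n^(-2β/(2β+1))`.

Censoring only helps the lower bound: the sample is a measurable image of the uncensored one, so an
estimator from censored data is also an estimator from the full data. This makes the constant
independent of `Q`.

Flipping one sign leaves the Hellinger affinity of a single observation above `1 - 2πδ²`
(`affinity_cosDensity`), hence that of `n` observations above `3/4`, and the coordinate cannot be
estimated well under both laws (`two_point_bound_flip`). Bessel's inequality (`bessel_cosDensity`)
bounds the `L²` loss below by the sum of coordinate losses, and averaging over the cube
(`cube_lower_bound`) adds up the two-point bounds. -/

/-! ### Integrals and densities on product spaces. -/

theorem lintegral_pi_prod_eq_pow {Ω : Type*} [MeasurableSpace Ω] (μ : Measure Ω) [SigmaFinite μ]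
    (n : ℕ) {f : Fin n → Ω → ℝ≥0∞} (hf : ∀ i, Measurable (f i)) :
    ∫⁻ y, ∏ i, f i (y i) ∂(Measure.pi fun _ : Fin n => μ) = ∏ i, ∫⁻ x, f i x ∂μ := by
  induction n with
  | zero => simp
  | succ n ih =>
    rw [← ((measurePreserving_piFinSuccAbove (fun _ : Fin (n + 1) => μ) 0).symm).lintegral_comp
      (by fun_prop)]
    have : ∀ x : Ω × (Fin n → Ω), ∏ i, f i
        ((MeasurableEquiv.piFinSuccAbove (fun _ : Fin (n + 1) => Ω) 0).symm x i) =
        f 0 x.1 * ∏ i : Fin n, f i.succ (x.2 i) := by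
      intro x
      simp [MeasurableEquiv.piFinSuccAbove_symm_apply, Fin.insertNthEquiv, Fin.prod_univ_succ]
    simp_rw [this]
    rw [lintegral_prod_mul (f := f 0) (g := fun y : Fin n → Ω => ∏ i : Fin n, f i.succ (y i))
      (hf 0).aemeasurable (Finset.measurable_prod _ fun i _ =>
        (hf i.succ).comp (measurable_pi_apply i)).aemeasurable, ih fun i => hf i.succ, Fin.prod_univ_succ]

theorem pi_withDensity_eq {Ω : Type*} [MeasurableSpace Ω] (μ : Measure Ω) [SigmaFinite μ]
    (n : ℕ) {p : Ω → ℝ≥0∞} (hp : Measurable p) [SigmaFinite (μ.withDensity p)] :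
    Measure.pi (fun _ : Fin n => μ.withDensity p) =
      (Measure.pi fun _ : Fin n => μ).withDensity fun y => ∏ i, p (y i) := by
  refine Measure.pi_eq fun s hs => ?_
  rw [withDensity_apply _ (.univ_pi hs), ← lintegral_indicator (.univ_pi hs)]
  have : ∀ y : Fin n → Ω, (Set.univ.pi s).indicator (fun y => ∏ i, p (y i)) y =
      ∏ i, (s i).indicator p (y i) := by
    intro y
    by_cases h : y ∈ Set.univ.pi s
    · rw [Set.indicator_of_mem h]
      exact Finset.prod_congr rfl fun i _ => (Set.indicator_of_mem (h i trivial) _).symm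
    · rw [Set.indicator_of_notMem h]
      simp only [Set.mem_univ_pi, not_forall] at h
      obtain ⟨i, hi⟩ := h
      exact (Finset.prod_eq_zero (Finset.mem_univ i) (Set.indicator_of_notMem hi _)).symm
  simp_rw [this]
  rw [lintegral_pi_prod_eq_pow μ n fun i => hp.indicator (hs i)]
  exact Finset.prod_congr rfl fun i _ => by
    rw [lintegral_indicator (hs i), withDensity_apply _ (hs i)]

/-! ### Two-point lower bound through the Hellinger affinity. -/

/-- Minimising over `a` leaves `4δ²pq/(p+q) + δ²(p+q)`, and AM-GM finishes. Being pointwise in the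
likelihoods `p`, `q`, it integrates directly to a risk bound. -/
theorem four_mul_sqrt_le {p q : ℝ} (hp : 0 ≤ p) (hq : 0 ≤ q) (a δ : ℝ) :
    4 * δ ^ 2 * √(p * q) ≤ p * (a - δ) ^ 2 + q * (a + δ) ^ 2 + δ ^ 2 * (p + q) := by
  obtain ⟨u, hu, rfl⟩ : ∃ u : ℝ, 0 ≤ u ∧ p = u ^ 2 := ⟨√p, by positivity, by simp [hp]⟩
  obtain ⟨v, hv, rfl⟩ : ∃ v : ℝ, 0 ≤ v ∧ q = v ^ 2 := ⟨√q, by positivity, by simp [hq]⟩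
  rw [← mul_pow, Real.sqrt_sq (by positivity)]
  -- Multiplying by `p + q` turns the difference of the two sides into a sum of two squares.
  have key : 0 ≤ (u ^ 2 + v ^ 2) * (u ^ 2 * (a - δ) ^ 2 + v ^ 2 * (a + δ) ^ 2
      + δ ^ 2 * (u ^ 2 + v ^ 2) - 4 * δ ^ 2 * (u * v)) := by
    have : (u ^ 2 + v ^ 2) * (u ^ 2 * (a - δ) ^ 2 + v ^ 2 * (a + δ) ^ 2
      + δ ^ 2 * (u ^ 2 + v ^ 2) - 4 * δ ^ 2 * (u * v)) =
      (u ^ 2 * (a - δ) + v ^ 2 * (a + δ)) ^ 2 + δ ^ 2 * (u ^ 2 + v ^ 2 - 2 * (u * v)) ^ 2 := by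
        ring
    rw [this]; positivity
  rcases (by positivity : 0 ≤ u ^ 2 + v ^ 2).eq_or_lt with h | h
  · have hu0 : u = 0 := by nlinarith [sq_nonneg u, sq_nonneg v]
    have hv0 : v = 0 := by nlinarith [sq_nonneg u, sq_nonneg v]
    simp [hu0, hv0]
  · have := nonneg_of_mul_nonneg_right key h
    linarith

/-- Integrate `four_mul_sqrt_le` at the two product likelihoods; the affinity of the product laws is
the `n`-th power of the affinity of one observation. -/
theorem two_point_bound {Ω : Type*} [MeasurableSpace Ω] (μ : Measure Ω) [SigmaFinite μ] (n : ℕ)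
    {f g : Ω → ℝ} (hf : Measurable f) (hg : Measurable g) (hf0 : ∀ x, 0 ≤ f x)
    (hg0 : ∀ x, 0 ≤ g x)
    [IsProbabilityMeasure (μ.withDensity fun x => ENNReal.ofReal (f x))]
    [IsProbabilityMeasure (μ.withDensity fun x => ENNReal.ofReal (g x))]
    {a : (Fin n → Ω) → ℝ} (ha : Measurable a) (δ : ℝ) :
    ENNReal.ofReal (4 * δ ^ 2) * (∫⁻ x, ENNReal.ofReal √(f x * g x) ∂μ) ^ n ≤
      ∫⁻ y, ENNReal.ofReal ((a y - δ) ^ 2)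
        ∂(Measure.pi fun _ => μ.withDensity fun x => ENNReal.ofReal (f x)) +
      ∫⁻ y, ENNReal.ofReal ((a y + δ) ^ 2)
        ∂(Measure.pi fun _ => μ.withDensity fun x => ENNReal.ofReal (g x)) +
      ENNReal.ofReal (2 * δ ^ 2) := by
  -- Spreading the constant over both probability laws supplies the term `δ² (p + q)` of the
  -- pointwise inequality.
  have hmass : ENNReal.ofReal (2 * δ ^ 2) =
      ∫⁻ _, ENNReal.ofReal (δ ^ 2)
        ∂(Measure.pi fun _ : Fin n => μ.withDensity fun x => ENNReal.ofReal (f x)) +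
      ∫⁻ _, ENNReal.ofReal (δ ^ 2)
        ∂(Measure.pi fun _ : Fin n => μ.withDensity fun x => ENNReal.ofReal (g x)) := by
    rw [lintegral_const, lintegral_const, measure_univ, measure_univ, mul_one,
      ← ENNReal.ofReal_add (by positivity) (by positivity), two_mul]
  have hpow : (∫⁻ x, ENNReal.ofReal √(f x * g x) ∂μ) ^ n =
      ∫⁻ y, ∏ i, ENNReal.ofReal √(f (y i) * g (y i)) ∂(Measure.pi fun _ : Fin n => μ) := by
    rw [lintegral_pi_prod_eq_pow μ n (f := fun _ x => ENNReal.ofReal √(f x * g x))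
      fun _ => by fun_prop]
    simp
  rw [hmass, hpow, pi_withDensity_eq μ n (by fun_prop), pi_withDensity_eq μ n (by fun_prop)]
  simp only [lintegral_withDensity_eq_lintegral_mul _
    (f := fun y : Fin n → Ω => ∏ i, ENNReal.ofReal (f (y i))) (by fun_prop)
    (by fun_prop : Measurable fun y => ENNReal.ofReal ((a y - δ) ^ 2)),
    lintegral_withDensity_eq_lintegral_mul _
    (f := fun y : Fin n → Ω => ∏ i, ENNReal.ofReal (f (y i))) (by fun_prop)
    (by fun_prop : Measurable fun y : Fin n → Ω => ENNReal.ofReal (δ ^ 2)),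
    lintegral_withDensity_eq_lintegral_mul _
    (f := fun y : Fin n → Ω => ∏ i, ENNReal.ofReal (g (y i))) (by fun_prop)
    (by fun_prop : Measurable fun y => ENNReal.ofReal ((a y + δ) ^ 2)),
    lintegral_withDensity_eq_lintegral_mul _
    (f := fun y : Fin n → Ω => ∏ i, ENNReal.ofReal (g (y i))) (by fun_prop)
    (by fun_prop : Measurable fun y : Fin n → Ω => ENNReal.ofReal (δ ^ 2)), Pi.mul_apply]
  rw [← lintegral_const_mul _ (by fun_prop), ← lintegral_add_left (by fun_prop),
    ← lintegral_add_left (by fun_prop), ← lintegral_add_left (by fun_prop)]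
  refine lintegral_mono fun y => ?_
  have hp : 0 ≤ ∏ i, f (y i) := Finset.prod_nonneg fun i _ => hf0 _
  have hq : 0 ≤ ∏ i, g (y i) := Finset.prod_nonneg fun i _ => hg0 _
  simp only
  rw [← ENNReal.ofReal_prod_of_nonneg fun i _ => hf0 _,
    ← ENNReal.ofReal_prod_of_nonneg fun i _ => hg0 _,
    ← ENNReal.ofReal_prod_of_nonneg fun i _ => Real.sqrt_nonneg _,
    ← ENNReal.ofReal_mul (by positivity), ← ENNReal.ofReal_mul hp, ← ENNReal.ofReal_mul hp,
    ← ENNReal.ofReal_mul hq, ← ENNReal.ofReal_mul hq,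
    ← ENNReal.ofReal_add (by positivity) (by positivity),
    ← ENNReal.ofReal_add (by positivity) (by positivity),
    ← ENNReal.ofReal_add (by positivity) (by positivity)]
  refine ENNReal.ofReal_le_ofReal ?_
  have hs : ∏ i, √(f (y i) * g (y i)) = √((∏ i, f (y i)) * ∏ i, g (y i)) := by
    rw [← Finset.prod_mul_distrib, Real.sqrt_prod _ fun i _ => mul_nonneg (hf0 _) (hg0 _)]
  rw [hs]
  linarith [four_mul_sqrt_le hp hq (a y) δ]

/-! ### Removing the censoring. -/

instance : IsFiniteMeasure arcMeasure := by
  unfold arcMeasure circle; infer_instance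

theorem isProbabilityMeasure_lawX {f : ℝ → ℝ} (hf : f ∈ densities) :
    IsProbabilityMeasure (lawX f) := by
  refine ⟨?_⟩
  rw [lawX, withDensity_apply _ .univ, Measure.restrict_univ,
    ← ofReal_integral_eq_lintegral_ofReal hf.1 hf.2.1, hf.2.2, ENNReal.ofReal_one]

theorem lawX_prod_eq {f : ℝ → ℝ} (hf : Measurable f) (Q : Measure (ℝ × ℝ)) [SFinite Q] :
    (lawX f).prod Q = (arcMeasure.prod Q).withDensity fun p => ENNReal.ofReal (f p.1) :=
  prod_withDensity_left (by fun_prop)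

theorem sampleLaw_eq_map (n : ℕ) (f : ℝ → ℝ) (hf : f ∈ densities) (Q : Measure (ℝ × ℝ))
    [IsProbabilityMeasure Q] :
    sampleLaw n f Q =
      (Measure.pi fun _ : Fin n => (lawX f).prod Q).map fun y i => censor (y i) := by
  have := isProbabilityMeasure_lawX hf
  have : IsProbabilityMeasure (((lawX f).prod Q).map censor) :=
    Measure.isProbabilityMeasure_map measurable_censor.aemeasurable
  exact (Measure.pi_map_pi fun _ => measurable_censor.aemeasurable).symm

/-- Composing `a` with the censoring map gives a statistic of the uncensored sample. There `Q` is a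
common factor of both laws, so it drops out of the affinity. -/
theorem sampleLaw_two_point_bound (n : ℕ) {f g : ℝ → ℝ} (hfd : f ∈ densities)
    (hgd : g ∈ densities) (hf : Measurable f) (hg : Measurable g) (hf0 : ∀ x, 0 ≤ f x)
    (hg0 : ∀ x, 0 ≤ g x) (Q : Measure (ℝ × ℝ)) [IsProbabilityMeasure Q]
    {a : (Fin n → ℝ × ℝ × ℝ) → ℝ} (ha : Measurable a) (δ : ℝ) :
    ENNReal.ofReal (4 * δ ^ 2) * (∫⁻ x, ENNReal.ofReal √(f x * g x) ∂arcMeasure) ^ n ≤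
      ∫⁻ z, ENNReal.ofReal ((a z - δ) ^ 2) ∂(sampleLaw n f Q) +
      ∫⁻ z, ENNReal.ofReal ((a z + δ) ^ 2) ∂(sampleLaw n g Q) +
      ENNReal.ofReal (2 * δ ^ 2) := by
  have := isProbabilityMeasure_lawX hfd
  have := isProbabilityMeasure_lawX hgd
  have hc : Measurable fun (y : Fin n → ℝ × ℝ × ℝ) i => censor (y i) :=
    measurable_pi_lambda _ fun i => measurable_censor.comp (measurable_pi_apply i)
  rw [sampleLaw_eq_map n f hfd, sampleLaw_eq_map n g hgd, lintegral_map (by fun_prop) hc,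
    lintegral_map (by fun_prop) hc, lawX_prod_eq hf, lawX_prod_eq hg]
  have i1 : IsProbabilityMeasure
      ((arcMeasure.prod Q).withDensity fun p => ENNReal.ofReal (f p.1)) := by
    rw [← lawX_prod_eq hf]; infer_instance
  have i2 : IsProbabilityMeasure
      ((arcMeasure.prod Q).withDensity fun p => ENNReal.ofReal (g p.1)) := by
    rw [← lawX_prod_eq hg]; infer_instance
  have h := two_point_bound (arcMeasure.prod Q) n (f := fun p => f p.1) (g := fun p => g p.1)
    (by fun_prop) (by fun_prop) (fun p => hf0 p.1) (fun p => hg0 p.1) (ha.comp hc) δ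
  rw [lintegral_prod _ (by fun_prop)] at h
  simpa using h

/-! ### Orthogonality relations of the trigonometric basis. -/

theorem integral_arcMeasure (h : ℝ → ℝ) :
    ∫ x, h x ∂arcMeasure = ∫ x in (0 : ℝ)..(2 * Real.pi), h x := by
  rw [intervalIntegral.integral_of_le (by positivity), arcMeasure, circle,
    integral_Ico_eq_integral_Ioc]

theorem integrable_arcMeasure {h : ℝ → ℝ} (hh : Continuous h) : Integrable h arcMeasure :=
  (hh.integrableOn_Icc (a := 0) (b := 2 * Real.pi)).mono_set Set.Ico_subset_Icc_self

theorem memLp_arcMeasure {h : ℝ → ℝ} (hh : Continuous h) : MemLp h 2 arcMeasure :=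
  (memLp_two_iff_integrable_sq hh.aestronglyMeasurable).2 (integrable_arcMeasure (by fun_prop))

theorem integral_arcMeasure_cos (m : ℤ) :
    ∫ x, Real.cos (m * x) ∂arcMeasure = if m = 0 then 2 * Real.pi else 0 := by
  rw [integral_arcMeasure]
  split_ifs with h
  · simp [h]
  · have hm : (m : ℝ) ≠ 0 := by exact_mod_cast h
    have h2 : (m : ℝ) * (2 * Real.pi) = ((2 * m : ℤ) : ℝ) * Real.pi := by push_cast; ring
    rw [intervalIntegral.integral_comp_mul_left (fun x => Real.cos x) hm, integral_cos, h2,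
      Real.sin_int_mul_pi]
    simp

theorem integral_arcMeasure_sin (m : ℤ) : ∫ x, Real.sin (m * x) ∂arcMeasure = 0 := by
  rw [integral_arcMeasure]
  by_cases h : m = 0
  · simp [h]
  · have hm : (m : ℝ) ≠ 0 := by exact_mod_cast h
    rw [intervalIntegral.integral_comp_mul_left (fun x => Real.sin x) hm, integral_sin,
      Real.cos_int_mul_two_pi]
    simp

theorem trigBasis_odd (i : ℕ) (x : ℝ) :
    trigBasis (2 * i + 1) x = 1 / √Real.pi * Real.cos (((i + 1 : ℕ) : ℤ) * x) := by
  have h : ¬ Even (2 * i + 1) := by simp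
  rw [trigBasis, if_neg (by lia), if_neg h]
  congr 3
  push_cast; ring

theorem trigBasis_even (i : ℕ) (x : ℝ) :
    trigBasis (2 * (i + 1)) x = 1 / √Real.pi * Real.sin (((i + 1 : ℕ) : ℤ) * x) := by
  rw [trigBasis, if_neg (by lia), if_pos (by simp)]
  congr 3
  push_cast; ring

theorem exists_index {j : ℕ} (hj : j ≠ 0) : ∃ k, j = 2 * k + 1 ∨ j = 2 * (k + 1) := by
  rcases Nat.even_or_odd' j with ⟨k, rfl | rfl⟩
  · exact ⟨k - 1, Or.inr (by lia)⟩
  · exact ⟨k, Or.inl rfl⟩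

theorem continuous_trigBasis (j : ℕ) : Continuous (trigBasis j) := by
  unfold trigBasis
  split_ifs <;> fun_prop

theorem integral_trigBasis {j : ℕ} (hj : j ≠ 0) : ∫ x, trigBasis j x ∂arcMeasure = 0 := by
  obtain ⟨k, rfl | rfl⟩ := exists_index hj
  · simp_rw [trigBasis_odd]
    rw [integral_const_mul, integral_arcMeasure_cos, if_neg (by lia), mul_zero]
  · simp_rw [trigBasis_even]
    rw [integral_const_mul, integral_arcMeasure_sin, mul_zero]

theorem integral_trigBasis_odd_mul (i : ℕ) {j : ℕ} (hj : j ≠ 0) :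
    ∫ x, trigBasis (2 * i + 1) x * trigBasis j x ∂arcMeasure = if j = 2 * i + 1 then 1 else 0 := by
  have hpi : 1 / √Real.pi * (1 / √Real.pi) = 1 / Real.pi := by
    rw [div_mul_div_comm, Real.mul_self_sqrt Real.pi_pos.le, one_mul]
  obtain ⟨k, rfl | rfl⟩ := exists_index hj
  · have : ∀ x, trigBasis (2 * i + 1) x * trigBasis (2 * k + 1) x =
        1 / (2 * Real.pi) * (Real.cos ((((i : ℤ) - k : ℤ) : ℝ) * x) +
          Real.cos ((((i : ℤ) + k + 2 : ℤ) : ℝ) * x)) := by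
      intro x
      have h := Real.two_mul_cos_mul_cos (((i + 1 : ℕ) : ℤ) * x) (((k + 1 : ℕ) : ℤ) * x)
      rw [trigBasis_odd, trigBasis_odd, mul_mul_mul_comm, hpi]
      have e1 : (((i : ℤ) - k : ℤ) : ℝ) * x =
        ((i + 1 : ℕ) : ℤ) * x - ((k + 1 : ℕ) : ℤ) * x := by push_cast; ring
      have e2 : (((i : ℤ) + k + 2 : ℤ) : ℝ) * x =
        ((i + 1 : ℕ) : ℤ) * x + ((k + 1 : ℕ) : ℤ) * x := by push_cast; ring
      rw [e1, e2, ← h]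
      ring
    simp_rw [this]
    rw [integral_const_mul, integral_add (integrable_arcMeasure (by fun_prop))
      (integrable_arcMeasure (by fun_prop)), integral_arcMeasure_cos, integral_arcMeasure_cos,
      if_neg (by lia : ¬ ((i : ℤ) + k + 2 = 0)), add_zero]
    by_cases h : k = i
    · rw [if_pos (by lia), if_pos (by lia)]
      field_simp
    · rw [if_neg (by lia), if_neg (by lia), mul_zero]
  · have : ∀ x, trigBasis (2 * i + 1) x * trigBasis (2 * (k + 1)) x =
        1 / (2 * Real.pi) * (Real.sin ((((k : ℤ) - i : ℤ) : ℝ) * x) +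
          Real.sin ((((k : ℤ) + i + 2 : ℤ) : ℝ) * x)) := by
      intro x
      have h := Real.two_mul_sin_mul_cos (((k + 1 : ℕ) : ℤ) * x) (((i + 1 : ℕ) : ℤ) * x)
      rw [trigBasis_odd, trigBasis_even, mul_mul_mul_comm, hpi]
      have e1 : (((k : ℤ) - i : ℤ) : ℝ) * x =
        ((k + 1 : ℕ) : ℤ) * x - ((i + 1 : ℕ) : ℤ) * x := by push_cast; ring
      have e2 : (((k : ℤ) + i + 2 : ℤ) : ℝ) * x =
        ((k + 1 : ℕ) : ℤ) * x + ((i + 1 : ℕ) : ℤ) * x := by push_cast; ring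
      rw [e1, e2, ← h]
      ring
    simp_rw [this]
    rw [integral_const_mul, integral_add (integrable_arcMeasure (by fun_prop))
      (integrable_arcMeasure (by fun_prop)), integral_arcMeasure_sin, integral_arcMeasure_sin,
      if_neg (by lia), add_zero, mul_zero]

/-! ### Cosine perturbations of the uniform density. -/

/-- The uniform density perturbed by the cosine polynomial of frequencies `1, …, N` with
coefficients `c`. -/
def cosDensity {N : ℕ} (c : Fin N → ℝ) (x : ℝ) : ℝ :=
  1 / (2 * Real.pi) + ∑ i, c i * trigBasis (2 * i + 1) x

theorem continuous_cosDensity {N : ℕ} (c : Fin N → ℝ) : Continuous (cosDensity c) := by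
  have := continuous_trigBasis
  unfold cosDensity
  fun_prop

theorem integral_cosDensity {N : ℕ} (c : Fin N → ℝ) : ∫ x, cosDensity c x ∂arcMeasure = 1 := by
  have hc := continuous_trigBasis
  unfold cosDensity
  rw [integral_add (integrable_arcMeasure (by fun_prop)) (integrable_arcMeasure (by fun_prop)),
    integral_finsetSum _ fun i _ => integrable_arcMeasure (by fun_prop)]
  simp_rw [integral_const_mul]
  rw [Finset.sum_eq_zero fun i _ => by rw [integral_trigBasis (by lia), mul_zero],
    integral_arcMeasure, intervalIntegral.integral_const]
  have := Real.pi_pos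
  simp only [smul_eq_mul]
  field_simp
  ring

theorem integral_cosDensity_mul {N : ℕ} (c : Fin N → ℝ) {j : ℕ} (hj : j ≠ 0) :
    ∫ x, cosDensity c x * trigBasis j x ∂arcMeasure =
      ∑ i, c i * if j = 2 * (i : ℕ) + 1 then 1 else 0 := by
  have hc := continuous_trigBasis
  unfold cosDensity
  simp_rw [add_mul, Finset.sum_mul, mul_assoc]
  rw [integral_add (integrable_arcMeasure (by fun_prop)) (integrable_arcMeasure (by fun_prop)),
    integral_finsetSum _ fun i _ => integrable_arcMeasure (by fun_prop)]
  simp_rw [integral_const_mul]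
  rw [integral_trigBasis hj, mul_zero, zero_add]
  exact Finset.sum_congr rfl fun i _ => by rw [integral_trigBasis_odd_mul _ hj]

theorem integral_cosDensity_mul_odd {N : ℕ} (c : Fin N → ℝ) (i : Fin N) :
    ∫ x, cosDensity c x * trigBasis (2 * i + 1) x ∂arcMeasure = c i := by
  rw [integral_cosDensity_mul c (by lia), Finset.sum_eq_single i]
  · simp
  · intro k _ hk
    rw [if_neg, mul_zero]
    intro h
    exact hk (Fin.ext (by lia))
  · simp

theorem abs_trigBasis_odd_le (i : ℕ) (x : ℝ) : |trigBasis (2 * i + 1) x| ≤ 1 := by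
  rw [trigBasis_odd, abs_mul, abs_of_nonneg (by positivity)]
  have : 1 ≤ √Real.pi := Real.one_le_sqrt.2 (by linarith [Real.pi_gt_three])
  have : 1 / √Real.pi ≤ 1 := by rw [div_le_one (by positivity)]; exact this
  exact mul_le_one₀ this (abs_nonneg _) (Real.abs_cos_le_one _)

/-- The perturbation is at most half the uniform height `1/(2π)`. This gives positivity and also the
uniform lower bound that controls the affinity. -/
theorem le_cosDensity {N : ℕ} {c : Fin N → ℝ} {δ : ℝ} (hc : ∀ i, |c i| ≤ δ)
    (hN : N * δ ≤ 1 / (4 * Real.pi)) (x : ℝ) : 1 / (4 * Real.pi) ≤ cosDensity c x := by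
  have h : |∑ i, c i * trigBasis (2 * i + 1) x| ≤ N * δ := by
    refine (Finset.abs_sum_le_sum_abs _ _).trans ?_
    calc ∑ i, |c i * trigBasis (2 * i + 1) x| ≤ ∑ _i : Fin N, δ := by
          refine Finset.sum_le_sum fun i _ => ?_
          rw [abs_mul]
          exact (mul_le_of_le_one_right (abs_nonneg _) (abs_trigBasis_odd_le _ _)).trans (hc i)
      _ = N * δ := by simp
  have h2 : 1 / (2 * Real.pi) = 2 * (1 / (4 * Real.pi)) := by field_simp; norm_num
  unfold cosDensity
  linarith [(abs_le.1 h).1]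

theorem cosDensity_mem_densities {N : ℕ} {c : Fin N → ℝ} {δ : ℝ} (hc : ∀ i, |c i| ≤ δ)
    (hN : N * δ ≤ 1 / (4 * Real.pi)) : cosDensity c ∈ densities :=
  ⟨integrable_arcMeasure (continuous_cosDensity c),
    ae_of_all _ fun x => le_trans (by positivity) (le_cosDensity hc hN x), integral_cosDensity c⟩

theorem cosDensity_mem_sobolevClass {β R : ℝ} (hβ : 0 < β) {N : ℕ} {c : Fin N → ℝ} {δ : ℝ}
    (hc : ∀ i, |c i| ≤ δ) (hN : N * ((2 * N) ^ (2 * β) * δ ^ 2) < R ^ 2 / Real.pi ^ (2 * β)) :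
    cosDensity c ∈ sobolevClass β R := by
  refine ⟨memLp_arcMeasure (continuous_cosDensity c), ?_⟩
  have hinj : Function.Injective fun i : Fin N => 2 * (i : ℕ) + 1 := by
    intro i k h
    exact Fin.ext (by simpa using h)
  rw [← hinj.tsum_eq, tsum_fintype]
  · have hb : ∀ i : Fin N, ENNReal.ofReal (sobolevWeight β (2 * i + 1) ^ 2 *
        |∫ x, cosDensity c x * trigBasis (2 * i + 1) x ∂arcMeasure| ^ 2) ≤
        ENNReal.ofReal ((2 * N) ^ (2 * β) * δ ^ 2) := by
      intro i
      have hodd : ¬ Even (2 * (i : ℕ) + 1) := by simp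
      rw [integral_cosDensity_mul_odd, sobolevWeight, if_neg hodd, ← Real.rpow_natCast,
        ← Real.rpow_mul (by positivity)]
      refine ENNReal.ofReal_le_ofReal (mul_le_mul ?_
        (pow_le_pow_left₀ (abs_nonneg _) (hc i) 2) (by positivity) (by positivity))
      -- The weight of mode `2i + 1` is `(2i + 2)^β`, hence at most `(2N)^β`.
      have hi : (i : ℝ) + 1 ≤ N := by exact_mod_cast i.2
      rw [mul_comm β]
      push_cast
      exact Real.rpow_le_rpow (by positivity) (by linarith) (by positivity)
    refine (Finset.sum_le_sum fun i _ => hb i).trans_lt ?_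
    rw [Finset.sum_const, Finset.card_univ, Fintype.card_fin, nsmul_eq_mul,
      ← ENNReal.ofReal_natCast, ← ENNReal.ofReal_mul (by positivity)]
    exact (ENNReal.ofReal_lt_ofReal_iff_of_nonneg (by positivity)).2 hN
  · intro j hj
    by_contra hr
    refine hj ?_
    rcases eq_or_ne j 0 with rfl | h0
    -- The constant mode is not small, but its weight is `0 ^ β = 0`.
    · simp [sobolevWeight, Real.zero_rpow hβ.ne']
    · beta_reduce
      rw [integral_cosDensity_mul c h0, Finset.sum_eq_zero]
      · simp
      · intro i _
        rw [if_neg, mul_zero]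
        exact fun h => hr ⟨i, h.symm⟩

/-! ### Affinity of neighbouring densities. -/

/-- With `s = √(pq)`, `(p - q)² = (p + q - 2s)(p + q + 2s)`, and the last factor is at least `4m`.
-/
theorem add_div_two_sub_le_sqrt {m p q : ℝ} (hm : 0 < m) (hp : m ≤ p) (hq : m ≤ q) :
    (p + q) / 2 - (p - q) ^ 2 / (8 * m) ≤ √(p * q) := by
  have h1 : m ≤ √(p * q) := by
    refine Real.le_sqrt_of_sq_le ?_
    nlinarith
  have h2 : √(p * q) ^ 2 = p * q := Real.sq_sqrt (by nlinarith)
  set s := √(p * q)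
  rw [sub_le_iff_le_add, ← sub_le_iff_le_add', le_div_iff₀ (by positivity)]
  have h3 : (p - q) ^ 2 = (p + q - 2 * s) * (p + q + 2 * s) := by
    linear_combination 4 * h2
  have h4 : 0 ≤ p + q - 2 * s := by
    have : 2 * s ≤ p + q := by
      refine abs_le_of_sq_le_sq' ?_ (by linarith) |>.2
      nlinarith [sq_nonneg (p - q)]
    linarith
  rw [h3]
  nlinarith

/-- Apply `add_div_two_sub_le_sqrt` with `m = 1/(4π)` and integrate: the densities differ by a
multiple of one unit vector, so the loss is `(π/2)(c i - d i)²`. -/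
theorem affinity_cosDensity {N : ℕ} {c d : Fin N → ℝ} {δ : ℝ} (hc : ∀ i, |c i| ≤ δ)
    (hd : ∀ i, |d i| ≤ δ) (hN : N * δ ≤ 1 / (4 * Real.pi)) (i : Fin N)
    (hcd : ∀ k, k ≠ i → c k = d k) (hi : |c i - d i| ≤ 2 * δ) :
    ENNReal.ofReal (1 - 2 * Real.pi * δ ^ 2) ≤
      ∫⁻ x, ENNReal.ofReal √(cosDensity c x * cosDensity d x) ∂arcMeasure := by
  have hcc := continuous_cosDensity c
  have hdc := continuous_cosDensity d
  have htc := continuous_trigBasis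
  rw [← ofReal_integral_eq_lintegral_ofReal (integrable_arcMeasure (by fun_prop))
    (ae_of_all _ fun x => Real.sqrt_nonneg _)]
  refine ENNReal.ofReal_le_ofReal ?_
  have hdiff : ∀ x, cosDensity c x - cosDensity d x = (c i - d i) * trigBasis (2 * i + 1) x := by
    intro x
    unfold cosDensity
    rw [add_sub_add_left_eq_sub, ← Finset.sum_sub_distrib, Finset.sum_eq_single i]
    · ring
    · intro k _ hk
      rw [hcd k hk, sub_self]
    · simp
  have hint : ∫ x, ((cosDensity c x + cosDensity d x) / 2 -
      (cosDensity c x - cosDensity d x) ^ 2 / (8 * (1 / (4 * Real.pi)))) ∂arcMeasure =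
      1 - Real.pi / 2 * (c i - d i) ^ 2 := by
    simp_rw [hdiff, mul_pow]
    rw [integral_sub (integrable_arcMeasure (by fun_prop)) (integrable_arcMeasure (by fun_prop)),
      integral_div, integral_div, integral_add (integrable_arcMeasure hcc)
      (integrable_arcMeasure hdc), integral_cosDensity, integral_cosDensity, integral_const_mul]
    simp_rw [pow_two (trigBasis _ _)]
    rw [integral_trigBasis_odd_mul _ (by lia), if_pos rfl]
    field_simp
    ring
  have hsq : (c i - d i) ^ 2 ≤ (2 * δ) ^ 2 := sq_le_sq' (abs_le.1 hi).1 (abs_le.1 hi).2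
  calc 1 - 2 * Real.pi * δ ^ 2 ≤ 1 - Real.pi / 2 * (c i - d i) ^ 2 := by
        nlinarith [Real.pi_pos]
    _ ≤ _ := by
        rw [← hint]
        exact integral_mono (integrable_arcMeasure (by fun_prop))
          (integrable_arcMeasure (by fun_prop)) fun x =>
            add_div_two_sub_le_sqrt (by positivity) (le_cosDensity hc hN x) (le_cosDensity hd hN x)

/-! ### Bessel's inequality for the loss. -/

theorem inner_toLp_arcMeasure {g h : ℝ → ℝ} (hg : MemLp g 2 arcMeasure)
    (hh : MemLp h 2 arcMeasure) :
    inner ℝ (hg.toLp g) (hh.toLp h) = ∫ x, h x * g x ∂arcMeasure := by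
  rw [L2.inner_def]
  refine integral_congr_ae ?_
  filter_upwards [hg.coeFn_toLp, hh.coeFn_toLp] with x h1 h2
  simp [h1, h2]

theorem bessel_cosDensity {N : ℕ} (c : Fin N → ℝ) {g : ℝ → ℝ} (hg : Measurable g) :
    ∑ i : Fin N, ENNReal.ofReal
        (((∫ x, g x * trigBasis (2 * i + 1) x ∂arcMeasure) - c i) ^ 2) ≤
      eLpNorm (fun x => g x - cosDensity c x) 2 arcMeasure ^ 2 := by
  have hcc := continuous_cosDensity c
  -- If the error is not square integrable the right side is infinite, whatever default values the
  -- coefficient integrals take.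
  by_cases hfin : MemLp (fun x => g x - cosDensity c x) 2 arcMeasure
  swap
  · have : eLpNorm (fun x => g x - cosDensity c x) 2 arcMeasure = ⊤ := by
      by_contra h
      exact hfin ⟨(hg.sub hcc.measurable).aestronglyMeasurable, lt_top_iff_ne_top.2 h⟩
    simp [this]
  have hφ : ∀ i : Fin N, MemLp (trigBasis (2 * i + 1)) 2 arcMeasure :=
    fun i => memLp_arcMeasure (continuous_trigBasis _)
  have hgm : MemLp g 2 arcMeasure := by
    convert hfin.add (memLp_arcMeasure hcc) using 1
    ext x; simp
  have horth : Orthonormal ℝ fun i => (hφ i).toLp _ := by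
    rw [orthonormal_iff_ite]
    intro i k
    rw [inner_toLp_arcMeasure, integral_trigBasis_odd_mul _ (by lia)]
    by_cases h : i = k
    · simp [h]
    · rw [if_neg h, if_neg]
      intro h'
      exact h (Fin.ext (by lia))
  have hb := horth.sum_inner_products_le (hfin.toLp _) (s := Finset.univ)
  rw [Lp.norm_toLp] at hb
  have hcoef : ∀ i : Fin N, (∫ x, g x * trigBasis (2 * i + 1) x ∂arcMeasure) - c i =
      inner ℝ ((hφ i).toLp _) (hfin.toLp _) := by
    intro i
    rw [inner_toLp_arcMeasure, ← integral_cosDensity_mul_odd c i, ← integral_sub]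
    · simp_rw [sub_mul]
    · exact hgm.integrable_mul (hφ i)
    · exact (memLp_arcMeasure hcc).integrable_mul (hφ i)
  rw [← ENNReal.ofReal_sum_of_nonneg fun i _ => sq_nonneg _, ← ENNReal.ofReal_toReal hfin.2.ne,
    ← ENNReal.ofReal_pow ENNReal.toReal_nonneg]
  refine ENNReal.ofReal_le_ofReal (le_trans (le_of_eq ?_) hb)
  refine Finset.sum_congr rfl fun i _ => ?_
  rw [hcoef, Real.norm_eq_abs, sq_abs]

/-! ### Assouad's hypercube. -/

/-- The sign `±1` encoded by a Boolean. -/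
def boolSign (b : Bool) : ℝ := if b then 1 else -1

theorem boolSign_not (b : Bool) : boolSign (!b) = -boolSign b := by
  cases b <;> simp [boolSign]

theorem boolSign_sq (b : Bool) : boolSign b ^ 2 = 1 := by
  cases b <;> simp [boolSign]

theorem abs_boolSign (b : Bool) : |boolSign b| = 1 := by
  cases b <;> simp [boolSign]

/-- The vertices of the hypercube of densities used in the lower bound. -/
def cubeDensity {N : ℕ} (δ : ℝ) (θ : Fin N → Bool) : ℝ → ℝ :=
  cosDensity fun i => δ * boolSign (θ i)

/-- Flipping one coordinate of a vertex of the hypercube. -/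
def flip {N : ℕ} (i : Fin N) (θ : Fin N → Bool) : Fin N → Bool := Function.update θ i (!θ i)

theorem flip_involutive {N : ℕ} (i : Fin N) : Function.Involutive (flip i) := by
  intro θ
  simp [flip]

theorem abs_cube_coeff_le {δ : ℝ} (hδ : 0 ≤ δ) (b : Bool) : |δ * boolSign b| ≤ δ := by
  rw [abs_mul, abs_boolSign, mul_one, abs_of_nonneg hδ]

theorem two_point_bound_flip {N n : ℕ} {δ : ℝ} (hδ : 0 ≤ δ) (hN : N * δ ≤ 1 / (4 * Real.pi))
    (hn : n * (2 * Real.pi * δ ^ 2) ≤ 1 / 4) (Q : Measure (ℝ × ℝ)) [IsProbabilityMeasure Q]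
    {a : (Fin n → ℝ × ℝ × ℝ) → ℝ} (ha : Measurable a) (i : Fin N) (θ : Fin N → Bool) :
    ENNReal.ofReal (δ ^ 2) ≤
      ∫⁻ z, ENNReal.ofReal ((a z - δ * boolSign (θ i)) ^ 2) ∂(sampleLaw n (cubeDensity δ θ) Q) +
      ∫⁻ z, ENNReal.ofReal ((a z - δ * boolSign (flip i θ i)) ^ 2)
        ∂(sampleLaw n (cubeDensity δ (flip i θ)) Q) := by
  have hc : ∀ (θ : Fin N → Bool) (i : Fin N), |δ * boolSign (θ i)| ≤ δ :=
    fun θ i => abs_cube_coeff_le hδ _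
  have hpos : ∀ (θ : Fin N → Bool) (x : ℝ), 0 ≤ cubeDensity δ θ x :=
    fun θ x => le_trans (by positivity) (le_cosDensity (hc θ) hN x)
  have hflip : flip i θ i = !θ i := by simp [flip]
  -- The signed value `δ * boolSign (θ i)` takes the place of `δ`, so both orientations of the flip
  -- are covered.
  have h := sampleLaw_two_point_bound n (cosDensity_mem_densities (hc θ) hN)
    (cosDensity_mem_densities (hc (flip i θ)) hN) (continuous_cosDensity _).measurable
    (continuous_cosDensity _).measurable (hpos θ) (hpos _) Q ha (δ * boolSign (θ i))
  have haff := affinity_cosDensity (hc θ) (hc (flip i θ)) hN i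
    (fun k hk => by simp [flip, hk]) (by
      rw [hflip, boolSign_not, mul_neg, sub_neg_eq_add, ← two_mul, abs_mul, abs_two]
      exact mul_le_mul_of_nonneg_left (hc θ i) two_pos.le)
  have hpow : ENNReal.ofReal (3 / 4) ≤ (∫⁻ x, ENNReal.ofReal √(cosDensity
      (fun i => δ * boolSign (θ i)) x * cosDensity (fun k => δ * boolSign (flip i θ k)) x)
      ∂arcMeasure) ^ n := by
    rcases n.eq_zero_or_pos with rfl | hn0
    · rw [pow_zero, ENNReal.ofReal_le_one]; norm_num
    · have h1 : (1 : ℝ) ≤ n := by exact_mod_cast hn0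
      have h0 : 0 ≤ 2 * Real.pi * δ ^ 2 := by positivity
      have h2 : 2 * Real.pi * δ ^ 2 ≤ 1 / 4 := by nlinarith
      refine le_trans ?_ (pow_le_pow_left' haff n)
      rw [← ENNReal.ofReal_pow (by linarith)]
      refine ENNReal.ofReal_le_ofReal ?_
      -- Bernoulli's inequality, with `n · 2πδ² ≤ 1/4`, yields `3/4`.
      have := one_add_mul_le_pow (a := -(2 * Real.pi * δ ^ 2)) (by linarith) n
      rw [← sub_eq_add_neg] at this
      linarith
  rw [hflip, boolSign_not]
  simp only [mul_neg, sub_neg_eq_add]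
  rw [mul_pow, boolSign_sq, mul_one] at h
  -- `4δ² · 3/4 = δ² + 2δ²`; the finite term `2δ²` then cancels.
  have h3 : ENNReal.ofReal (δ ^ 2) + ENNReal.ofReal (2 * δ ^ 2) ≤
      ENNReal.ofReal (4 * δ ^ 2) * ENNReal.ofReal (3 / 4) := by
    rw [← ENNReal.ofReal_add (by positivity) (by positivity),
      ← ENNReal.ofReal_mul (by positivity)]
    exact ENNReal.ofReal_le_ofReal (by linarith)
  exact (ENNReal.add_le_add_iff_right ENNReal.ofReal_ne_top).1
    ((h3.trans (mul_le_mul_right hpow _)).trans h)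

/-- The worst risk dominates the average over the cube. For each coordinate, pairing every vertex
with its flip counts the average twice, hence the factor `2`. -/
theorem cube_lower_bound {N n : ℕ} {δ : ℝ} (hδ : 0 ≤ δ) (hN : N * δ ≤ 1 / (4 * Real.pi))
    (hn : n * (2 * Real.pi * δ ^ 2) ≤ 1 / 4) (Q : Measure (ℝ × ℝ)) [IsProbabilityMeasure Q]
    (r : ℝ) {fhat : (Fin n → ℝ × ℝ × ℝ) → ℝ → ℝ} (hfhat : fhat ∈ estimators n) {S : ℝ≥0∞}
    (hS : ∀ θ : Fin N → Bool, scaledRisk n Q r fhat (cubeDensity δ θ) ≤ S) :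
    ENNReal.ofReal r * (N * ENNReal.ofReal (δ ^ 2)) ≤ 2 * S := by
  have hfm : Measurable (Function.uncurry fhat) := hfhat
  have hφ := continuous_trigBasis
  let a : Fin N → (Fin n → ℝ × ℝ × ℝ) → ℝ :=
    fun i z => ∫ x, fhat z x * trigBasis (2 * i + 1) x ∂arcMeasure
  have ha : ∀ i, Measurable (a i) := by
    intro i
    have hm : Measurable fun p : (Fin n → ℝ × ℝ × ℝ) × ℝ =>
        fhat p.1 p.2 * trigBasis (2 * i + 1) p.2 :=
      hfm.mul ((hφ _).measurable.comp measurable_snd)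
    exact (hm.stronglyMeasurable.integral_prod_right).measurable
  let G : Fin N → (Fin N → Bool) → ℝ≥0∞ := fun i θ =>
    ∫⁻ z, ENNReal.ofReal ((a i z - δ * boolSign (θ i)) ^ 2) ∂(sampleLaw n (cubeDensity δ θ) Q)
  have hrisk : ∀ θ, ENNReal.ofReal r * ∑ i, G i θ ≤ S := by
    intro θ
    refine le_trans ?_ (hS θ)
    rw [← lintegral_finsetSum _ fun i _ => by have := ha i; fun_prop]
    refine (lintegral_const_mul_le _ _).trans (lintegral_mono fun z => ?_)
    exact mul_le_mul_right (bessel_cosDensity _ (hfm.comp measurable_prodMk_left)) _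
  have hG : ∀ i, (Fintype.card (Fin N → Bool) : ℝ≥0∞) * ENNReal.ofReal (δ ^ 2) ≤
      2 * ∑ θ, G i θ := by
    intro i
    have hflip : ∑ θ, G i (flip i θ) = ∑ θ, G i θ :=
      Equiv.sum_comp (flip_involutive i).toPerm (G i)
    calc (Fintype.card (Fin N → Bool) : ℝ≥0∞) * ENNReal.ofReal (δ ^ 2)
        = ∑ _θ : Fin N → Bool, ENNReal.ofReal (δ ^ 2) := by simp
      _ ≤ ∑ θ, (G i θ + G i (flip i θ)) :=
          Finset.sum_le_sum fun θ _ => two_point_bound_flip hδ hN hn Q (ha i) i θ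
      _ = 2 * ∑ θ, G i θ := by rw [Finset.sum_add_distrib, hflip, two_mul]
  have hcard : (Fintype.card (Fin N → Bool) : ℝ≥0∞) ≠ 0 := by simp
  have hcard' : (Fintype.card (Fin N → Bool) : ℝ≥0∞) ≠ ⊤ := ENNReal.natCast_ne_top _
  -- Multiplying by the number of vertices replaces averages by sums.
  refine (ENNReal.mul_le_mul_iff_right hcard hcard').1 ?_
  calc (Fintype.card (Fin N → Bool) : ℝ≥0∞) * (ENNReal.ofReal r * (N * ENNReal.ofReal (δ ^ 2)))
      = ENNReal.ofReal r * ∑ _i : Fin N,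
          ((Fintype.card (Fin N → Bool) : ℝ≥0∞) * ENNReal.ofReal (δ ^ 2)) := by
        rw [Finset.sum_const, Finset.card_univ, Fintype.card_fin, nsmul_eq_mul]
        ring
    _ ≤ ENNReal.ofReal r * ∑ i, 2 * ∑ θ, G i θ :=
        mul_le_mul_right (Finset.sum_le_sum fun i _ => hG i) _
    _ = 2 * ∑ θ, ENNReal.ofReal r * ∑ i, G i θ := by
        rw [← Finset.mul_sum, Finset.sum_comm, ← Finset.mul_sum]
        ring
    _ ≤ 2 * ∑ _θ : Fin N → Bool, S :=
        mul_le_mul_right (Finset.sum_le_sum fun θ _ => hrisk θ) _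
    _ = Fintype.card (Fin N → Bool) * (2 * S) := by
        rw [Finset.sum_const, Finset.card_univ, nsmul_eq_mul]
        ring

end CircularCensoring

end

/-! ### Choice of the parameters. -/

theorem theorem1 (β R : ℝ) (hβ : 1 / 2 ≤ β) (hR : 0 < R) :
    ∃ c : ℝ, 0 < c ∧ ∀ Q : Measure (ℝ × ℝ), CircularCensoring.IsCensoringLaw Q →
      ENNReal.ofReal c ≤
        liminf (fun n : ℕ =>
          ⨅ fhat ∈ CircularCensoring.estimators n,
            ⨆ f ∈ CircularCensoring.sobolevClass β R ∩ CircularCensoring.densities,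
              CircularCensoring.scaledRisk n Q ((n : ℝ) ^ (2 * β / (2 * β + 1))) fhat f)
          atTop := by
  have hpi := Real.pi_gt_three
  -- With `δ² = κ/n`, the first bound on `κ` keeps the densities positive and the second keeps them
  -- in the Sobolev ball. The affinity condition `hκ3` follows from the first.
  obtain ⟨κ, hκ, hκ1, hκ2⟩ : ∃ κ : ℝ, 0 < κ ∧ κ ≤ (1 / (4 * Real.pi)) ^ 2 ∧
      2 ^ (2 * β) * κ < R ^ 2 / Real.pi ^ (2 * β) := by
    have hB : 0 < R ^ 2 / Real.pi ^ (2 * β) / 2 ^ (2 * β) / 2 := by positivity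
    refine ⟨min ((1 / (4 * Real.pi)) ^ 2) (R ^ 2 / Real.pi ^ (2 * β) / 2 ^ (2 * β) / 2),
      lt_min (by positivity) hB, min_le_left _ _, ?_⟩
    rw [← lt_div_iff₀' (by positivity)]
    exact (min_le_right _ _).trans_lt (by linarith)
  have hκ3 : 2 * Real.pi * κ ≤ 1 / 4 := by
    refine (mul_le_mul_of_nonneg_left hκ1 (by positivity)).trans ?_
    have : 2 * Real.pi * (1 / (4 * Real.pi)) ^ 2 = 1 / (8 * Real.pi) := by field_simp; norm_num
    rw [this]
    exact one_div_le_one_div_of_le (by norm_num) (by linarith)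
  refine ⟨κ / 4, by positivity, fun Q hQ => ?_⟩
  have := hQ.1
  refine le_liminf_of_le (by isBoundedDefault) ?_
  filter_upwards [eventually_ge_atTop 1] with n hn1
  refine le_iInf₂ fun fhat hfhat => ?_
  have hn1' : (1 : ℝ) ≤ n := by exact_mod_cast hn1
  have hn0 : (0 : ℝ) < n := by linarith
  set t : ℝ := (n : ℝ) ^ (1 / (2 * β + 1)) with ht
  have ht1 : 1 ≤ t := Real.one_le_rpow hn1' (by positivity)
  have htn : t ^ (2 * β + 1) = n := by
    rw [ht, ← Real.rpow_mul hn0.le, one_div_mul_cancel (by positivity), Real.rpow_one]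
  have htr : t * (n : ℝ) ^ (2 * β / (2 * β + 1)) = n := by
    rw [ht, ← Real.rpow_add hn0, ← add_div, add_comm 1, div_self (by positivity), Real.rpow_one]
  -- Here `β ≥ 1/2` matters: `t² ≤ t^(2β+1) = n` makes `N δ` bounded by `√κ`.
  have htsq : t ^ 2 ≤ n := by
    rw [← Real.rpow_natCast, ← htn]
    exact Real.rpow_le_rpow_of_exponent_le ht1 (by push_cast; linarith)
  set N : ℕ := ⌊t⌋₊
  have hNt : (N : ℝ) ≤ t := Nat.floor_le (by linarith)
  have hN1 : (1 : ℝ) ≤ N := by exact_mod_cast (Nat.one_le_floor_iff t).2 ht1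
  have htN : t / 2 ≤ N := by linarith [Nat.lt_floor_add_one t]
  set δ : ℝ := √(κ / n)
  have hδ : 0 ≤ δ := Real.sqrt_nonneg _
  have hδ2 : δ ^ 2 = κ / n := Real.sq_sqrt (by positivity)
  have hNδ : N * δ ≤ 1 / (4 * Real.pi) := by
    refine abs_le_of_sq_le_sq' ?_ (by positivity) |>.2
    refine le_trans ?_ hκ1
    rw [mul_pow, hδ2, mul_div_assoc', div_le_iff₀ hn0, mul_comm]
    refine mul_le_mul_of_nonneg_left (le_trans ?_ htsq) hκ.le
    exact pow_le_pow_left₀ (by positivity) hNt 2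
  have hnδ : n * (2 * Real.pi * δ ^ 2) ≤ 1 / 4 := by
    rw [hδ2]
    refine le_trans (le_of_eq ?_) hκ3
    field_simp
  have hNβ : N * ((2 * N) ^ (2 * β) * δ ^ 2) < R ^ 2 / Real.pi ^ (2 * β) := by
    refine lt_of_le_of_lt ?_ hκ2
    have hpow : (N : ℝ) * (N : ℝ) ^ (2 * β) ≤ n := by
      rw [← htn, mul_comm, ← Real.rpow_add_one (by positivity)]
      exact Real.rpow_le_rpow (by positivity) hNt (by positivity)
    rw [Real.mul_rpow (by norm_num) (by positivity), hδ2]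
    calc (N : ℝ) * (2 ^ (2 * β) * (N : ℝ) ^ (2 * β) * (κ / n))
        = (N : ℝ) * (N : ℝ) ^ (2 * β) * (2 ^ (2 * β) * κ / n) := by ring
      _ ≤ n * (2 ^ (2 * β) * κ / n) := mul_le_mul_of_nonneg_right hpow (by positivity)
      _ = 2 ^ (2 * β) * κ := by field_simp
  have hc : ∀ (θ : Fin N → Bool) (i : Fin N), |δ * CircularCensoring.boolSign (θ i)| ≤ δ :=
    fun θ i => CircularCensoring.abs_cube_coeff_le hδ _
  have hmain := CircularCensoring.cube_lower_bound hδ hNδ hnδ Q ((n : ℝ) ^ (2 * β / (2 * β + 1)))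
    hfhat fun θ => le_iSup₂
      (f := fun f (_ : f ∈ CircularCensoring.sobolevClass β R ∩ CircularCensoring.densities) =>
        CircularCensoring.scaledRisk n Q ((n : ℝ) ^ (2 * β / (2 * β + 1))) fhat f)
      (CircularCensoring.cubeDensity δ θ)
      ⟨CircularCensoring.cosDensity_mem_sobolevClass (by linarith) (hc θ) hNβ,
        CircularCensoring.cosDensity_mem_densities (hc θ) hNδ⟩
  refine (ENNReal.mul_le_mul_iff_right two_ne_zero ENNReal.ofNat_ne_top).1 (le_trans ?_ hmain)
  rw [← ENNReal.ofReal_natCast, ← ENNReal.ofReal_mul (by positivity),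
    ← ENNReal.ofReal_mul (by positivity), ← ENNReal.ofReal_ofNat,
    ← ENNReal.ofReal_mul (by norm_num)]
  refine ENNReal.ofReal_le_ofReal ?_
  rw [hδ2]
  -- `N ≥ t/2` costs one factor `2` and the averaging bound another, giving `κ/4`.
  calc 2 * (κ / 4) = t * (n : ℝ) ^ (2 * β / (2 * β + 1)) * (κ / n) / 2 := by
        rw [htr]; field_simp; norm_num
    _ = (n : ℝ) ^ (2 * β / (2 * β + 1)) * (t / 2 * (κ / n)) := by ring
    _ ≤ (n : ℝ) ^ (2 * β / (2 * β + 1)) * (N * (κ / n)) := by gcongr
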